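/- Let $\mathcal X$ be a measurable space, $k:\mathcal X\times\mathcal X\to\mathbb R$ a measurable positive semidefinite kernel with $\sup_x k(x,x)<\infty$, and let $f$ be an element of its reproducing kernel Hilbert space, with norm $\|f\|_k$. Let $\sigma>0$, $\delta\in(0,1)$ and $T\in\mathbb N$. For $t=1,\dots,T$ one observes $y_t=f(X_t)+\varepsilon_t$, where for a filtration $(\mathcal F_t)_{t\ge0}$ the (random) point $X_t\in\mathcal X$ is $\mathcal F_{t-1}$-measurable (so it may be chosen by any rule from the past observations, or by external randomisation such as uniform sampling), $\varepsilon_t$ is $\mathcal F_t$-measurable with $\mathbb E[\varepsilon_t\mid\mathcal F_{t-1}]=0$, and $|\varepsilon_t|\le\sigma$ almost surely. Let $\mu_t$ and $\sigma_t^2$ be the predictive mean and variance of Gaussian process regression with prior $\mathcal{GP}(0,k)$ and noise variance $\sigma^2$ based on the first $t$ observations, i.e. with $K_t=[k(X_i,X_j)]_{i,j\le t}$, $k_t(x)=[k(x,X_i)]_{i\le t}$ and $y_{1..t}=[y_i]_{i\le t}$, $$\mu_t(x)=k_t(x)^{\top}(K_t+\sigma^2I)^{-1}y_{1..t},\qquad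 \sigma_t^2(x)=k(x,x)-k_t(x)^{\top}(K_t+\sigma^2I)^{-1}k_t(x)$$ (so $\mu_0=0$, $\sigma_0^2(x)=k(x,x)$). Let $$\eta_t=\sup_{x_1,\dots,x_t\in\mathcal X}\tfrac12\log\det\bigl(I+\sigma^{-2}[k(x_i,x_j)]_{i,j\le t}\bigr)$$ be the maximal information gain from $t$ observations, and let $(\beta_t)_{t\ge1}$ be real numbers with $$\beta_t\ge 2\|f\|_k^2+300\,\eta_t\log^3(t/\delta)\qquad(t\ge1).$$ Then there is an event of probability at least $1-\delta$ on which, simultaneously for all $x\in\mathcal X$: (i) $|\mu_t(x)-f(x)|\le\beta_t^{1/2}\sigma_t(x)$ for all $2\le t\le T$, and also for $t=1$ (if $T\ge1$) provided that $\delta\le 3/4$; (ii) $|\mu_t(x)-f(x)|\le\beta_{t+1}^{1/2}\sigma_t(x)$ for all $0\le t\le T$. -/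

import Mathlib

open MeasureTheory ProbabilityTheory

noncomputable section

namespace GPUCB

variable {X : Type*}

/-- The kernel matrix `[k (x i) (x j)]` of the points `x 0, …, x (n - 1)`. -/
def gram (k : X → X → ℝ) {n : ℕ} (x : Fin n → X) : Matrix (Fin n) (Fin n) ℝ :=
  Matrix.of fun i j => k (x i) (x j)

/-- Predictive mean at `z` of Gaussian process regression with prior `GP(0, k)` and noise variance
`σ ^ 2`, from the observations `y i` at the points `x i`. With `n` observations and regularisation
parameter `ρ = σ ^ 2 / n`, the regularised matrix `K + n ρ I` is `K + σ ^ 2 I`. -/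
def postMean (k : X → X → ℝ) (σ : ℝ) {n : ℕ} (x : Fin n → X) (y : Fin n → ℝ) (z : X) : ℝ :=
  (fun i => k z (x i)) ⬝ᵥ ((gram k x + σ ^ 2 • (1 : Matrix (Fin n) (Fin n) ℝ))⁻¹.mulVec y)

/-- Predictive variance at `z` of the same Gaussian process regression. -/
def postVar (k : X → X → ℝ) (σ : ℝ) {n : ℕ} (x : Fin n → X) (z : X) : ℝ :=
  k z z - (fun i => k z (x i)) ⬝ᵥ
    ((gram k x + σ ^ 2 • (1 : Matrix (Fin n) (Fin n) ℝ))⁻¹.mulVec fun i => k z (x i))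

/-- Predictive standard deviation. -/
def postStd (k : X → X → ℝ) (σ : ℝ) {n : ℕ} (x : Fin n → X) (z : X) : ℝ :=
  √(postVar k σ x z)

/-- Information gain `½ log det (I + σ⁻² K)`: the mutual information between `f ∼ GP(0, k)` and
the observations of `f` at the points `x i` with independent `N(0, σ ^ 2)` noise. -/
def infoGain (k : X → X → ℝ) (σ : ℝ) {n : ℕ} (x : Fin n → X) : ℝ :=
  1 / 2 * Real.log (1 + (σ ^ 2)⁻¹ • gram k x).det

/-- The highest information gain from `n` observations. It is finite when `k` is bounded on the
diagonal. -/
def maxInfoGain (k : X → X → ℝ) (σ : ℝ) (n : ℕ) : ℝ :=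
  ⨆ x : Fin n → X, infoGain k σ x

/-- The first `t` terms of a sequence `a 1, a 2, …` indexed from `1`. -/
def firstTerms {α : Type*} (a : ℕ → α) (t : ℕ) : Fin t → α := fun i => a (i + 1)

end GPUCB

end

/-! Write `Q` for the noise energy `eᵀ K (K + σ² I)⁻¹ e / σ²`. Cauchy-Schwarz in the feature space
gives, deterministically, an error of at most `(‖f‖ + √Q) σ_t(z)` at every `z` at once, and `(‖f‖ +
√Q)² ≤ 2‖f‖² + 2Q`. So it is enough to show `Q ≤ 150 η_t log³(t/δ)` for the relevant times
(`abs_postMean_sub_le`).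

For a fixed `lam`, `exp (fitForm K lam e / (2σ²)) / √det(I + K/lam)` has expectation at most 1
(`integral_mixWeight_le_one`). Schur complements isolate the effect of one more observation
(`gainDet_succ`, `fitForm_succ`). The new factor is a convex function of the new noise, hence lies
below its chord over `[-σ, σ]`. The chord is affine with predictable slope and midpoint value at
most 1 (`exp_halfIncr_le`), so conditionally centred noise does not raise the mean. Markov's
inequality at level `t²/δ` and a union bound over `t ≥ 2` then control `fitForm K lam e` by `4
log(t/δ) + log det(I + K/lam)` in units of `σ²`.

With `lam = σ²` the logarithmic term carries no factor `η_t`, which is too weak when `η_t < 1`.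
There `lam = σ² η_t` is used instead: returning to `σ²` costs a factor `3 η_t`, while the
log-determinant stays at most 2 (`fitForm_le_mul_fitForm`, `log_gainDet_mul_le`). Time `t = 1` needs
only the bound on the noise. -/

noncomputable section

namespace GPUCB

open Matrix
open scoped RealInnerProductSpace

/-! ### Spectral form of the noise energy and of the determinant. -/

/-- The quadratic form `eᵀ K (K + lam I)⁻¹ e`, written as `eᵀ e - lam eᵀ (K + lam I)⁻¹ e`. -/
def fitForm {n : ℕ} (K : Matrix (Fin n) (Fin n) ℝ) (lam : ℝ) (e : Fin n → ℝ) : ℝ :=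
  e ⬝ᵥ e - lam * (e ⬝ᵥ (K + lam • (1 : Matrix (Fin n) (Fin n) ℝ))⁻¹ *ᵥ e)

/-- The determinant `det (I + lam⁻¹ K)`. -/
def gainDet {n : ℕ} (K : Matrix (Fin n) (Fin n) ℝ) (lam : ℝ) : ℝ :=
  (1 + lam⁻¹ • K).det

/-- Simultaneous diagonalisation of the forms `fitForm K lam` and of `gainDet K lam`. -/
theorem exists_spectral {n : ℕ} {K : Matrix (Fin n) (Fin n) ℝ} (hK : K.PosSemidef) :
    ∃ a : Fin n → ℝ, (∀ i, 0 ≤ a i) ∧ K.trace = ∑ i, a i ∧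
      (∀ lam, 0 < lam → gainDet K lam = ∏ i, (1 + a i / lam)) ∧
      ∀ e : Fin n → ℝ, ∃ u : Fin n → ℝ, e ⬝ᵥ e = ∑ i, u i ^ 2 ∧
        ∀ lam, 0 < lam → fitForm K lam e = ∑ i, a i / (a i + lam) * u i ^ 2 := by
  have hH := hK.isHermitian
  set U : Matrix (Fin n) (Fin n) ℝ := (hH.eigenvectorUnitary : Matrix (Fin n) (Fin n) ℝ) with hU
  set a := hH.eigenvalues with ha
  have hUU : Uᵀ * U = 1 := by
    have := Unitary.coe_star_mul_self hH.eigenvectorUnitary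
    rwa [Matrix.star_eq_conjTranspose, Matrix.conjTranspose_eq_transpose_of_trivial] at this
  have hUU' : U * Uᵀ = 1 := mul_eq_one_comm.mp hUU
  have hKU : K = U * diagonal a * Uᵀ := by
    have := hH.spectral_theorem
    rw [Unitary.conjStarAlgAut_apply, Matrix.star_eq_conjTranspose,
      Matrix.conjTranspose_eq_transpose_of_trivial] at this
    exact this
  have h0 : ∀ i, 0 ≤ a i := hK.eigenvalues_nonneg
  have hconj : ∀ c d : ℝ, c • (1 : Matrix (Fin n) (Fin n) ℝ) + d • K
      = U * diagonal (fun i => c + d * a i) * Uᵀ := by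
    intro c d
    have : diagonal (fun i => c + d * a i)
        = c • (1 : Matrix (Fin n) (Fin n) ℝ) + d • diagonal a := by
      ext i j
      by_cases h : i = j <;> simp [h]
    rw [this, Matrix.mul_add, Matrix.add_mul]
    simp [hUU', ← hKU]
  refine ⟨a, h0, by simpa using hH.trace_eq_sum_eigenvalues, fun lam hlam => ?_, fun e => ?_⟩
  · have := hconj 1 lam⁻¹
    rw [one_smul] at this
    rw [gainDet, this, det_mul_right_comm, hUU', one_mul, det_diagonal]
    simp [div_eq_inv_mul]
  · have he : e ⬝ᵥ e = ∑ i, (Uᵀ *ᵥ e) i ^ 2 := by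
      have : e ⬝ᵥ e = (Uᵀ *ᵥ e) ⬝ᵥ (Uᵀ *ᵥ e) := by
        rw [dotProduct_mulVec, vecMul_transpose, mulVec_mulVec, hUU', one_mulVec]
      rw [this]
      simp [dotProduct, sq]
    refine ⟨Uᵀ *ᵥ e, he, fun lam hlam => ?_⟩
    have hinv : (K + lam • (1 : Matrix (Fin n) (Fin n) ℝ))⁻¹
        = U * diagonal (fun i => (lam + a i)⁻¹) * Uᵀ := by
      apply Matrix.inv_eq_right_inv
      have := hconj lam 1
      rw [one_smul, add_comm] at this
      rw [this]
      calc _ = U * (diagonal (fun i => lam + 1 * a i) * (Uᵀ * U) *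
            diagonal (fun i => (lam + a i)⁻¹)) * Uᵀ := by
            simp only [Matrix.mul_assoc]
        _ = 1 := by
            rw [hUU, Matrix.mul_one, diagonal_mul_diagonal]
            have : (fun i => (lam + 1 * a i) * (lam + a i)⁻¹) = fun _ => (1 : ℝ) := by
              funext i
              have := h0 i
              rw [one_mul, mul_inv_cancel₀ (by positivity)]
            rw [this, diagonal_one, Matrix.mul_one, hUU']
    have hq : e ⬝ᵥ (K + lam • (1 : Matrix (Fin n) (Fin n) ℝ))⁻¹ *ᵥ e
        = ∑ i, (lam + a i)⁻¹ * (Uᵀ *ᵥ e) i ^ 2 := by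
      rw [hinv, ← mulVec_mulVec, ← mulVec_mulVec, dotProduct_mulVec, ← mulVec_transpose]
      simp only [dotProduct, mulVec_diagonal]
      exact Finset.sum_congr rfl fun i _ => by ring
    rw [fitForm, hq, he, Finset.mul_sum, ← Finset.sum_sub_distrib]
    refine Finset.sum_congr rfl fun i _ => ?_
    have := h0 i
    have h1 : lam + a i ≠ 0 := by positivity
    have h2 : a i + lam ≠ 0 := by positivity
    field_simp
    ring

/-! ### Inequalities read off the eigenvalues. -/

section Consequences

variable {n : ℕ} {K : Matrix (Fin n) (Fin n) ℝ} {lam : ℝ}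

theorem one_le_gainDet (hK : K.PosSemidef) (hlam : 0 < lam) : 1 ≤ gainDet K lam := by
  obtain ⟨a, h0, -, hdet, -⟩ := exists_spectral hK
  rw [hdet lam hlam]
  refine Finset.one_le_prod fun i _ => ?_
  have := div_nonneg (h0 i) hlam.le
  linarith

theorem log_gainDet_nonneg (hK : K.PosSemidef) (hlam : 0 < lam) : 0 ≤ Real.log (gainDet K lam) :=
  Real.log_nonneg (one_le_gainDet hK hlam)

theorem log_gainDet_le_trace (hK : K.PosSemidef) (hlam : 0 < lam) :
    Real.log (gainDet K lam) ≤ K.trace / lam := by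
  obtain ⟨a, h0, htr, hdet, -⟩ := exists_spectral hK
  have h1 : ∀ i, 0 ≤ a i / lam := fun i => div_nonneg (h0 i) hlam.le
  rw [hdet lam hlam, Real.log_prod fun i _ => by have := h1 i; positivity, htr, Finset.sum_div]
  refine Finset.sum_le_sum fun i _ => ?_
  have := Real.log_le_sub_one_of_pos (show 0 < 1 + a i / lam by have := h1 i; positivity)
  linarith

theorem fitForm_nonneg (hK : K.PosSemidef) (hlam : 0 < lam) (e : Fin n → ℝ) :
    0 ≤ fitForm K lam e := by
  obtain ⟨a, h0, -, -, hfit⟩ := exists_spectral hK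
  obtain ⟨u, -, hu⟩ := hfit e
  rw [hu lam hlam]
  exact Finset.sum_nonneg fun i _ => by have := h0 i; positivity

theorem fitForm_le_dotProduct (hK : K.PosSemidef) (hlam : 0 < lam) (e : Fin n → ℝ) :
    fitForm K lam e ≤ e ⬝ᵥ e := by
  obtain ⟨a, h0, -, -, hfit⟩ := exists_spectral hK
  obtain ⟨u, he, hu⟩ := hfit e
  rw [hu lam hlam, he]
  refine Finset.sum_le_sum fun i _ => mul_le_of_le_one_left (sq_nonneg _) ?_
  have := h0 i
  rw [div_le_one (by positivity)]
  linarith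

theorem div_add_le_log {a lam : ℝ} (ha : 0 ≤ a) (hlam : 0 < lam) :
    a / (a + lam) ≤ Real.log (1 + a / lam) := by
  have h := Real.one_sub_inv_le_log_of_pos (show 0 < 1 + a / lam by positivity)
  have : 1 - (1 + a / lam)⁻¹ = a / (a + lam) := by
    field_simp
    ring
  linarith

/-- If `a` is an eigenvalue of `K` then `a / (a + lam)` is at most `log (gainDet K lam)`. -/
theorem div_add_le_log_prod {a : Fin n → ℝ} (h0 : ∀ i, 0 ≤ a i) (hlam : 0 < lam) (i : Fin n) :
    a i / (a i + lam) ≤ Real.log (∏ i, (1 + a i / lam)) := by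
  have h1 : ∀ i, 0 ≤ a i / lam := fun i => div_nonneg (h0 i) hlam.le
  rw [Real.log_prod fun i _ => by have := h1 i; positivity]
  refine (div_add_le_log (h0 i) hlam).trans
    (Finset.single_le_sum (f := fun i => Real.log (1 + a i / lam)) (fun j _ => ?_)
      (Finset.mem_univ i))
  exact Real.log_nonneg (by have := h1 j; linarith)

/-- Every spectral weight is at most the whole log-determinant. The bound vanishes with the
information gain, which settles the cases `η = 0` and `t = 1`. -/
theorem fitForm_le_dotProduct_mul_log (hK : K.PosSemidef) (hlam : 0 < lam) (e : Fin n → ℝ) :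
    fitForm K lam e ≤ Real.log (gainDet K lam) * (e ⬝ᵥ e) := by
  obtain ⟨a, h0, -, hdet, hfit⟩ := exists_spectral hK
  obtain ⟨u, he, hu⟩ := hfit e
  rw [hu lam hlam, he, hdet lam hlam, Finset.mul_sum]
  exact Finset.sum_le_sum fun i _ =>
    mul_le_mul_of_nonneg_right (div_add_le_log_prod h0 hlam i) (sq_nonneg _)

/-- Passing to a smaller regularisation parameter. -/
theorem fitForm_le_mul_fitForm (hK : K.PosSemidef) (hlam : 0 < lam) {η : ℝ} (hη : 0 < η)
    (hdetη : Real.log (gainDet K lam) ≤ 2 * η) (e : Fin n → ℝ) :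
    fitForm K lam e ≤ 3 * η * fitForm K (lam * η) e := by
  obtain ⟨a, h0, -, hdet, hfit⟩ := exists_spectral hK
  obtain ⟨u, he, hu⟩ := hfit e
  rw [hu lam hlam, hu (lam * η) (by positivity), Finset.mul_sum]
  refine Finset.sum_le_sum fun i _ => ?_
  rw [← mul_assoc]
  refine mul_le_mul_of_nonneg_right ?_ (sq_nonneg _)
  have hi := h0 i
  have h1 : a i / (a i + lam) ≤ 2 * η := by
    rw [hdet lam hlam] at hdetη
    exact (div_add_le_log_prod h0 hlam i).trans hdetη
  rw [div_le_iff₀ (by positivity)] at h1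
  rw [← mul_div_assoc, div_le_div_iff₀ (by positivity) (by positivity)]
  -- From `a ≤ 2η(a + lam)` it follows that `a + lam η ≤ 3η(a + lam)`; this is the source of the
  -- factor 3.
  have : a i * (a i + lam * η) ≤ a i * (3 * η * (a i + lam)) :=
    mul_le_mul_of_nonneg_left (by nlinarith [mul_nonneg hη.le hi]) hi
  linarith

/-- Bernoulli's inequality `1 + s/η ≤ (1 + s)^(1/η)`, applied to each eigenvalue. -/
theorem log_gainDet_mul_le (hK : K.PosSemidef) (hlam : 0 < lam) {η : ℝ} (hη : 0 < η)
    (hη1 : η ≤ 1) : Real.log (gainDet K (lam * η)) ≤ Real.log (gainDet K lam) / η := by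
  obtain ⟨a, h0, -, hdet, -⟩ := exists_spectral hK
  have hp : ∀ l, 0 < l → ∀ i, 0 < 1 + a i / l := fun l hl i => by have := h0 i; positivity
  have hlη : 0 < lam * η := by positivity
  rw [hdet _ hlam, hdet _ hlη, Real.log_prod fun i _ => (hp _ hlη i).ne',
    Real.log_prod fun i _ => (hp _ hlam i).ne', Finset.sum_div]
  refine Finset.sum_le_sum fun i _ => ?_
  have hi := h0 i
  have hb := one_add_mul_self_le_rpow_one_add (s := a i / lam) (p := η⁻¹)
    (by have : 0 ≤ a i / lam := by positivity
        linarith) ((one_le_inv₀ hη).mpr hη1)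
  have h2 : 1 + η⁻¹ * (a i / lam) = 1 + a i / (lam * η) := by field_simp
  rw [h2] at hb
  calc _ ≤ Real.log ((1 + a i / lam) ^ η⁻¹) := Real.log_le_log (hp _ hlη i) hb
    _ = _ := by rw [Real.log_rpow (hp _ hlam i)]; ring

theorem isUnit_det_add_smul_one (hK : K.PosSemidef) (hlam : 0 < lam) :
    IsUnit (K + lam • (1 : Matrix (Fin n) (Fin n) ℝ)).det := by
  have h : K + lam • (1 : Matrix (Fin n) (Fin n) ℝ) = lam • (1 + lam⁻¹ • K) := by
    rw [smul_add, smul_smul, mul_inv_cancel₀ hlam.ne', one_smul, add_comm]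
  rw [h, det_smul, isUnit_iff_ne_zero]
  have := one_le_gainDet hK hlam
  rw [gainDet] at this
  positivity

end Consequences

/-! ### Adding one observation: Schur complements. -/

section Bordered

variable {n : ℕ}

theorem det_bordered (M : Matrix (Fin (n + 1)) (Fin (n + 1)) ℝ) (A : Matrix (Fin n) (Fin n) ℝ)
    (v : Fin n → ℝ) (hA : ∀ i j, M i.castSucc j.castSucc = A i j)
    (hv : ∀ i, M i.castSucc (Fin.last n) = v i) (hv' : ∀ i, M (Fin.last n) i.castSucc = v i)
    (hdet : IsUnit A.det) :
    M.det = A.det * (M (Fin.last n) (Fin.last n) - v ⬝ᵥ A⁻¹ *ᵥ v) := by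
  have : Invertible A := A.invertibleOfIsUnitDet hdet
  have hM : M.submatrix finSumFinEquiv finSumFinEquiv
      = fromBlocks A (of fun i (_ : Fin 1) => v i) (of fun (_ : Fin 1) i => v i)
        (of fun _ _ => M (Fin.last n) (Fin.last n)) := by
    ext i j
    rcases i with i | i <;> rcases j with j | j
    · exact hA i j
    · rw [Subsingleton.elim j 0]
      exact hv i
    · rw [Subsingleton.elim i 0]
      exact hv' j
    · rw [Subsingleton.elim i 0, Subsingleton.elim j 0]
      rfl
  rw [← det_submatrix_equiv_self finSumFinEquiv M, hM, det_fromBlocks₁₁, det_fin_one]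
  congr 1
  simp [Matrix.sub_apply, Matrix.mul_apply, dotProduct, mulVec, Finset.mul_sum, Finset.sum_mul,
    mul_assoc, invOf_eq_nonsing_inv]
  rw [Finset.sum_comm]

theorem dotProduct_inv_mulVec_bordered (M : Matrix (Fin (n + 1)) (Fin (n + 1)) ℝ)
    (A : Matrix (Fin n) (Fin n) ℝ) (v : Fin n → ℝ)
    (hA : ∀ i j, M i.castSucc j.castSucc = A i j)
    (hv : ∀ i, M i.castSucc (Fin.last n) = v i) (hv' : ∀ i, M (Fin.last n) i.castSucc = v i)
    (hAs : A.IsSymm) (hdet : IsUnit A.det)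
    (hd : M (Fin.last n) (Fin.last n) - v ⬝ᵥ A⁻¹ *ᵥ v ≠ 0) (e : Fin (n + 1) → ℝ) :
    e ⬝ᵥ M⁻¹ *ᵥ e = Fin.init e ⬝ᵥ A⁻¹ *ᵥ Fin.init e +
      (e (Fin.last n) - v ⬝ᵥ A⁻¹ *ᵥ Fin.init e) ^ 2 /
        (M (Fin.last n) (Fin.last n) - v ⬝ᵥ A⁻¹ *ᵥ v) := by
  set d := M (Fin.last n) (Fin.last n) - v ⬝ᵥ A⁻¹ *ᵥ v with hdd
  set r := (e (Fin.last n) - v ⬝ᵥ A⁻¹ *ᵥ Fin.init e) / d with hr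
  set b : Fin n → ℝ := A⁻¹ *ᵥ Fin.init e - r • A⁻¹ *ᵥ v with hb
  have hMdet : IsUnit M.det := by
    rw [det_bordered M A v hA hv hv' hdet]
    exact hdet.mul (isUnit_iff_ne_zero.mpr hd)
  have hAb : A *ᵥ b = Fin.init e - r • v := by
    rw [hb, mulVec_sub, mulVec_smul, mulVec_mulVec, mulVec_mulVec, mul_nonsing_inv _ hdet,
      one_mulVec, one_mulVec]
  have hvb : v ⬝ᵥ b = v ⬝ᵥ A⁻¹ *ᵥ Fin.init e - r * (v ⬝ᵥ A⁻¹ *ᵥ v) := by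
    rw [hb, dotProduct_sub, dotProduct_smul, smul_eq_mul]
  -- Block elimination: the last coordinate `r` of the solution is the residual divided by the Schur
  -- complement.
  have hsol : M *ᵥ (Fin.snoc b r : Fin (n + 1) → ℝ) = e := by
    funext i
    refine Fin.lastCases ?_ (fun i => ?_) i
    · simp only [mulVec, dotProduct, Fin.sum_univ_castSucc, Fin.snoc_castSucc, Fin.snoc_last, hv']
      have : ∑ i, v i * b i = v ⬝ᵥ b := rfl
      rw [this, hvb]
      have : r * d = e (Fin.last n) - v ⬝ᵥ A⁻¹ *ᵥ Fin.init e := div_mul_cancel₀ _ hd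
      linear_combination this + r * hdd
    · simp only [mulVec, dotProduct, Fin.sum_univ_castSucc, Fin.snoc_castSucc, Fin.snoc_last, hA,
        hv]
      have : ∑ j, A i j * b j = (A *ᵥ b) i := rfl
      rw [this, hAb]
      simp [Fin.init]
      ring
  have hinv : M⁻¹ *ᵥ e = (Fin.snoc b r : Fin (n + 1) → ℝ) := by
    rw [← hsol, mulVec_mulVec, nonsing_inv_mul _ hMdet, one_mulVec]
  have hsymm : Fin.init e ⬝ᵥ A⁻¹ *ᵥ v = v ⬝ᵥ A⁻¹ *ᵥ Fin.init e := by
    rw [dotProduct_mulVec, ← mulVec_transpose, transpose_nonsing_inv, hAs.eq, dotProduct_comm]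
  have hsum : e ⬝ᵥ M⁻¹ *ᵥ e = Fin.init e ⬝ᵥ b + e (Fin.last n) * r := by
    rw [hinv]
    simp [dotProduct, Fin.sum_univ_castSucc, Fin.init]
  rw [hsum, hb, dotProduct_sub, dotProduct_smul, hsymm, smul_eq_mul, hr]
  field_simp
  ring

variable {K : Matrix (Fin (n + 1)) (Fin (n + 1)) ℝ} {lam : ℝ}

/-- The leading principal submatrix of size `n`. -/
def leading (K : Matrix (Fin (n + 1)) (Fin (n + 1)) ℝ) : Matrix (Fin n) (Fin n) ℝ :=
  K.submatrix Fin.castSucc Fin.castSucc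

/-- The last column, without its last entry. -/
def lastCol (K : Matrix (Fin (n + 1)) (Fin (n + 1)) ℝ) : Fin n → ℝ :=
  fun i => K i.castSucc (Fin.last n)

/-- The ratio of the determinants `gainDet` of a matrix and of its leading submatrix. -/
def gainRatio (K : Matrix (Fin (n + 1)) (Fin (n + 1)) ℝ) (lam : ℝ) : ℝ :=
  (K (Fin.last n) (Fin.last n) + lam -
    lastCol K ⬝ᵥ (leading K + lam • (1 : Matrix (Fin n) (Fin n) ℝ))⁻¹ *ᵥ lastCol K) / lam

/-- The regularised prediction of the last coordinate from the others. -/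
def lastPred (K : Matrix (Fin (n + 1)) (Fin (n + 1)) ℝ) (lam : ℝ) (e : Fin n → ℝ) : ℝ :=
  lastCol K ⬝ᵥ (leading K + lam • (1 : Matrix (Fin n) (Fin n) ℝ))⁻¹ *ᵥ e

theorem posSemidef_leading (hK : K.PosSemidef) : (leading K).PosSemidef := hK.submatrix _

theorem isSymm_of_posSemidef {m : ℕ} {K : Matrix (Fin m) (Fin m) ℝ} (hK : K.PosSemidef) :
    K.IsSymm := by
  have := hK.isHermitian.eq
  rwa [Matrix.conjTranspose_eq_transpose_of_trivial] at this

/-- Test `K ≥ 0` on `(w, -1)`, where `w` solves the regularised system for the last column. This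
bounds the Schur complement below by `lam + lam ‖w‖²`. -/
theorem one_le_gainRatio (hK : K.PosSemidef) (hlam : 0 < lam) : 1 ≤ gainRatio K lam := by
  set A := leading K + lam • (1 : Matrix (Fin n) (Fin n) ℝ) with hA
  set v := lastCol K with hv
  have hdet : IsUnit A.det := isUnit_det_add_smul_one (posSemidef_leading hK) hlam
  set w : Fin n → ℝ := A⁻¹ *ᵥ v with hw
  have hAw : leading K *ᵥ w + lam • w = v := by
    have : A *ᵥ w = v := by rw [hw, mulVec_mulVec, mul_nonsing_inv _ hdet, one_mulVec]
    rw [← this, hA, add_mulVec, smul_mulVec, one_mulVec]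
  have hsymm : ∀ i, K (Fin.last n) i = K i (Fin.last n) := fun i =>
    (isSymm_of_posSemidef hK).apply _ _
  have hpos := hK.dotProduct_mulVec_nonneg (Fin.snoc w (-1) : Fin (n + 1) → ℝ)
  have hexp : (Fin.snoc w (-1) : Fin (n + 1) → ℝ) ⬝ᵥ K *ᵥ (Fin.snoc w (-1) : Fin (n + 1) → ℝ)
      = w ⬝ᵥ leading K *ᵥ w - 2 * (v ⬝ᵥ w) + K (Fin.last n) (Fin.last n) := by
    have h1 : ∀ i : Fin n, (K *ᵥ (Fin.snoc w (-1) : Fin (n + 1) → ℝ)) i.castSucc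
        = (leading K *ᵥ w) i - v i := by
      intro i
      simp [mulVec, dotProduct, Fin.sum_univ_castSucc, leading, hv, lastCol, sub_eq_add_neg]
    have h2 : (K *ᵥ (Fin.snoc w (-1) : Fin (n + 1) → ℝ)) (Fin.last n)
        = v ⬝ᵥ w - K (Fin.last n) (Fin.last n) := by
      simp [mulVec, dotProduct, Fin.sum_univ_castSucc, hv, lastCol, sub_eq_add_neg, hsymm]
    have h3 : (Fin.snoc w (-1) : Fin (n + 1) → ℝ) ⬝ᵥ K *ᵥ (Fin.snoc w (-1) : Fin (n + 1) → ℝ)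
        = w ⬝ᵥ (leading K *ᵥ w - v) - (v ⬝ᵥ w - K (Fin.last n) (Fin.last n)) := by
      rw [dotProduct, Fin.sum_univ_castSucc, h2]
      simp only [Fin.snoc_castSucc, h1, Fin.snoc_last]
      simp only [dotProduct, Pi.sub_apply]
      ring
    rw [h3, dotProduct_sub, dotProduct_comm w v]
    ring
  have hstar : star (Fin.snoc w (-1) : Fin (n + 1) → ℝ) = Fin.snoc w (-1) := star_trivial _
  rw [hstar, hexp] at hpos
  have hwv : w ⬝ᵥ leading K *ᵥ w = v ⬝ᵥ w - lam * (w ⬝ᵥ w) := by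
    have : leading K *ᵥ w = v - lam • w := by rw [← hAw]; simp
    rw [this, dotProduct_sub, dotProduct_smul, dotProduct_comm, smul_eq_mul]
  have hww : 0 ≤ w ⬝ᵥ w := Finset.sum_nonneg fun i _ => mul_self_nonneg _
  rw [gainRatio, le_div_iff₀ hlam, one_mul]
  have := mul_nonneg hlam.le hww
  change lam ≤ _ + lam - v ⬝ᵥ w
  linarith

theorem gainDet_succ (hK : K.PosSemidef) (hlam : 0 < lam) :
    gainDet K lam = gainDet (leading K) lam * gainRatio K lam := by
  have h : ∀ {m : ℕ} (B : Matrix (Fin m) (Fin m) ℝ),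
      (B + lam • (1 : Matrix (Fin m) (Fin m) ℝ)).det = lam ^ m * gainDet B lam := by
    intro m B
    have : B + lam • (1 : Matrix (Fin m) (Fin m) ℝ) = lam • (1 + lam⁻¹ • B) := by
      rw [smul_add, smul_smul, mul_inv_cancel₀ hlam.ne', one_smul, add_comm]
    rw [this, det_smul, gainDet, Fintype.card_fin]
  have hb := det_bordered (K + lam • (1 : Matrix (Fin (n + 1)) (Fin (n + 1)) ℝ))
    (leading K + lam • (1 : Matrix (Fin n) (Fin n) ℝ)) (lastCol K)
    (fun i j => by simp [leading, Matrix.one_apply])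
    (fun i => by simp [lastCol, Fin.castSucc_ne_last])
    (fun i => by
      simp [lastCol, (Fin.castSucc_ne_last i).symm,
        (isSymm_of_posSemidef hK).apply])
    (isUnit_det_add_smul_one (posSemidef_leading hK) hlam)
  rw [h, h] at hb
  have hl : lam ^ n ≠ 0 := by positivity
  refine mul_left_cancel₀ (pow_ne_zero (n + 1) hlam.ne') ?_
  rw [hb, gainRatio]
  simp only [Matrix.add_apply, Matrix.smul_apply, Matrix.one_apply_eq, smul_eq_mul, mul_one]
  field_simp
  ring

/-- The last noise enters only through an explicit quadratic, whose coefficients depend on the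
points and the earlier noise. This is what makes a one-step martingale argument possible. -/
theorem fitForm_succ (hK : K.PosSemidef) (hlam : 0 < lam) (e : Fin (n + 1) → ℝ) :
    fitForm K lam e = fitForm (leading K) lam (Fin.init e) +
      (e (Fin.last n) ^ 2 -
        (e (Fin.last n) - lastPred K lam (Fin.init e)) ^ 2 / gainRatio K lam) := by
  have hone := one_le_gainRatio hK hlam
  have hd : (K + lam • (1 : Matrix (Fin (n + 1)) (Fin (n + 1)) ℝ)) (Fin.last n) (Fin.last n) -
      lastCol K ⬝ᵥ (leading K + lam • (1 : Matrix (Fin n) (Fin n) ℝ))⁻¹ *ᵥ lastCol K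
      = lam * gainRatio K lam := by
    rw [gainRatio]
    simp only [Matrix.add_apply, Matrix.smul_apply, Matrix.one_apply_eq, smul_eq_mul, mul_one]
    field_simp
  have hne : lam * gainRatio K lam ≠ 0 := by positivity
  have hb := dotProduct_inv_mulVec_bordered
    (K + lam • (1 : Matrix (Fin (n + 1)) (Fin (n + 1)) ℝ))
    (leading K + lam • (1 : Matrix (Fin n) (Fin n) ℝ)) (lastCol K)
    (fun i j => by simp [leading, Matrix.one_apply])
    (fun i => by simp [lastCol, Fin.castSucc_ne_last])
    (fun i => by
      simp [lastCol, (Fin.castSucc_ne_last i).symm,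
        (isSymm_of_posSemidef hK).apply])
    ((isSymm_of_posSemidef (posSemidef_leading hK)).add (Matrix.isSymm_one.smul lam))
    (isUnit_det_add_smul_one (posSemidef_leading hK) hlam) (by rw [hd]; exact hne) e
  rw [hd] at hb
  have he : e ⬝ᵥ e = Fin.init e ⬝ᵥ Fin.init e + e (Fin.last n) ^ 2 := by
    simp [dotProduct, Fin.sum_univ_castSucc, Fin.init, sq]
  rw [fitForm, fitForm, hb, he, lastPred]
  field_simp
  ring

end Bordered

/-! ### Deterministic error bound in the feature space. -/

section FeatureMap

variable {X H : Type*} [NormedAddCommGroup H] [InnerProductSpace ℝ H] {k : X → X → ℝ}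
  {φ : X → H} {n : ℕ}

theorem posSemidef_gram (hφ : ∀ x y, ⟪φ x, φ y⟫ = k x y) (x : Fin n → X) :
    (gram k x).PosSemidef := by
  have : gram k x = Matrix.gram ℝ (fun i => φ (x i)) := by
    ext i j
    simp [gram, Matrix.gram, hφ]
  rw [this]
  exact Matrix.posSemidef_gram ..

theorem inner_sum_sum (hφ : ∀ x y, ⟪φ x, φ y⟫ = k x y) (x : Fin n → X) (a b : Fin n → ℝ) :
    ⟪∑ i, a i • φ (x i), ∑ i, b i • φ (x i)⟫ = a ⬝ᵥ gram k x *ᵥ b := by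
  simp only [sum_inner, inner_sum, real_inner_smul_left, real_inner_smul_right, hφ, dotProduct,
    mulVec, gram, of_apply, Finset.mul_sum]
  rw [Finset.sum_comm]
  exact Finset.sum_congr rfl fun i _ => Finset.sum_congr rfl fun j _ => by ring

theorem inner_sum_right (hφ : ∀ x y, ⟪φ x, φ y⟫ = k x y) (x : Fin n → X) (a : Fin n → ℝ) (z : X) :
    ⟪φ z, ∑ i, a i • φ (x i)⟫ = (fun i => k z (x i)) ⬝ᵥ a := by
  simp only [inner_sum, real_inner_smul_right, hφ, dotProduct]
  exact Finset.sum_congr rfl fun i _ => by ring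

/-- The weights of the observations in the predictive mean. -/
def postWeight (k : X → X → ℝ) (σ : ℝ) (x : Fin n → X) (z : X) : Fin n → ℝ :=
  (gram k x + σ ^ 2 • (1 : Matrix (Fin n) (Fin n) ℝ))⁻¹ *ᵥ fun i => k z (x i)

theorem add_smul_one_mulVec_inv_mulVec {K : Matrix (Fin n) (Fin n) ℝ} {lam : ℝ}
    (hK : K.PosSemidef) (hlam : 0 < lam) (v : Fin n → ℝ) :
    K *ᵥ ((K + lam • (1 : Matrix (Fin n) (Fin n) ℝ))⁻¹ *ᵥ v) +
      lam • ((K + lam • (1 : Matrix (Fin n) (Fin n) ℝ))⁻¹ *ᵥ v) = v := by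
  have hdet := isUnit_det_add_smul_one hK hlam
  conv_rhs => rw [← one_mulVec v, ← mul_nonsing_inv _ hdet, ← mulVec_mulVec, add_mulVec,
    smul_mulVec, one_mulVec]

/-- The variance is the squared norm of the pair (feature residual, `σ` times the weights) in `H ×
ℝⁿ`, which prepares it for Cauchy-Schwarz. -/
theorem postVar_eq (hφ : ∀ x y, ⟪φ x, φ y⟫ = k x y) {σ : ℝ} (hσ : 0 < σ) (x : Fin n → X) (z : X) :
    postVar k σ x z = ‖∑ i, postWeight k σ x z i • φ (x i) - φ z‖ ^ 2 +
      σ ^ 2 * (postWeight k σ x z ⬝ᵥ postWeight k σ x z) := by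
  set a := postWeight k σ x z with ha
  set v : Fin n → ℝ := fun i => k z (x i) with hv
  have hsolve : gram k x *ᵥ a + σ ^ 2 • a = v :=
    add_smul_one_mulVec_inv_mulVec (posSemidef_gram hφ x) (by positivity) v
  have h1 : postVar k σ x z = k z z - v ⬝ᵥ a := rfl
  have h2 : a ⬝ᵥ v = a ⬝ᵥ gram k x *ᵥ a + σ ^ 2 * (a ⬝ᵥ a) := by
    rw [← hsolve, dotProduct_add, dotProduct_smul, smul_eq_mul]
  rw [h1, norm_sub_sq_real, ← real_inner_self_eq_norm_sq, ← real_inner_self_eq_norm_sq,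
    inner_sum_sum hφ, hφ, real_inner_comm, inner_sum_right hφ]
  rw [dotProduct_comm] at h2
  change k z z - v ⬝ᵥ a = a ⬝ᵥ gram k x *ᵥ a - 2 * (v ⬝ᵥ a) + k z z + σ ^ 2 * (a ⬝ᵥ a)
  linarith

/-- With `b = (K + σ² I)⁻¹ e`, `u` the feature residual and `w = ∑ bᵢ φ(xᵢ)`, the number `a ⬝ᵥ e` is
the inner product of `(u, σ a)` and `(-w, K b / σ)` in `H × ℝⁿ`. The squared norms of these pairs
are the two factors on the right. -/
theorem sq_postWeight_dotProduct_le (hφ : ∀ x y, ⟪φ x, φ y⟫ = k x y) {σ : ℝ} (hσ : 0 < σ)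
    (x : Fin n → X) (e : Fin n → ℝ) (z : X) :
    (postWeight k σ x z ⬝ᵥ e) ^ 2 ≤
      postVar k σ x z * (fitForm (gram k x) (σ ^ 2) e / σ ^ 2) := by
  have hlam : 0 < σ ^ 2 := by positivity
  have hK := posSemidef_gram hφ x
  rw [postVar_eq hφ hσ]
  set K := gram k x with hKdef
  set a := postWeight k σ x z with ha
  set v : Fin n → ℝ := fun i => k z (x i) with hv
  set b := (K + σ ^ 2 • (1 : Matrix (Fin n) (Fin n) ℝ))⁻¹ *ᵥ e with hb
  have hsolve : K *ᵥ a + σ ^ 2 • a = v := add_smul_one_mulVec_inv_mulVec hK hlam v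
  have hsolve' : K *ᵥ b + σ ^ 2 • b = e := add_smul_one_mulVec_inv_mulVec hK hlam e
  set u := ∑ i, a i • φ (x i) - φ z with hu
  set w := ∑ i, b i • φ (x i) with hw
  have hsymm : ∀ c d : Fin n → ℝ, c ⬝ᵥ K *ᵥ d = d ⬝ᵥ K *ᵥ c := by
    intro c d
    rw [dotProduct_mulVec, ← mulVec_transpose, (isSymm_of_posSemidef hK).eq, dotProduct_comm]
  have huw : ⟪u, w⟫ = -(σ ^ 2 * (a ⬝ᵥ b)) := by
    rw [hu, hw, inner_sub_left, inner_sum_sum hφ, inner_sum_right hφ]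
    change a ⬝ᵥ K *ᵥ b - v ⬝ᵥ b = _
    rw [← hsolve, add_dotProduct, smul_dotProduct, dotProduct_comm (K *ᵥ a), hsymm a b, smul_eq_mul]
    ring
  have hae : a ⬝ᵥ e = -⟪u, w⟫ + a ⬝ᵥ K *ᵥ b := by
    rw [huw, ← hsolve', dotProduct_add, dotProduct_smul, smul_eq_mul]
    ring
  have hww : ‖w‖ ^ 2 = b ⬝ᵥ K *ᵥ b := by
    rw [← real_inner_self_eq_norm_sq, hw, inner_sum_sum hφ]
  have hfit : fitForm K (σ ^ 2) e / σ ^ 2 = ‖w‖ ^ 2 + (K *ᵥ b) ⬝ᵥ (K *ᵥ b) / σ ^ 2 := by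
    have h1 : fitForm K (σ ^ 2) e = e ⬝ᵥ K *ᵥ b := by
      have : K *ᵥ b = e - σ ^ 2 • b := by rw [← hsolve']; simp
      rw [this, dotProduct_sub, dotProduct_smul, smul_eq_mul]
      rfl
    rw [h1, hww]
    nth_rewrite 1 [← hsolve']
    rw [add_dotProduct, smul_dotProduct, smul_eq_mul]
    field_simp
    ring
  have hcs : (a ⬝ᵥ K *ᵥ b) ^ 2 ≤ (a ⬝ᵥ a) * ((K *ᵥ b) ⬝ᵥ (K *ᵥ b)) := by
    have := Finset.sum_mul_sq_le_sq_mul_sq Finset.univ a (K *ᵥ b)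
    simpa only [dotProduct, ← sq] using this
  have ha0 : 0 ≤ a ⬝ᵥ a := Finset.sum_nonneg fun i _ => mul_self_nonneg _
  have hb0 : 0 ≤ (K *ᵥ b) ⬝ᵥ (K *ᵥ b) := Finset.sum_nonneg fun i _ => mul_self_nonneg _
  have h1 : |⟪u, w⟫| ≤ ‖u‖ * ‖w‖ := abs_real_inner_le_norm u w
  have h2 : |a ⬝ᵥ K *ᵥ b| ≤ √(a ⬝ᵥ a) * √((K *ᵥ b) ⬝ᵥ (K *ᵥ b)) := by
    rw [← Real.sqrt_mul ha0]
    exact Real.abs_le_sqrt hcs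
  have h3 : |a ⬝ᵥ e| ≤ ‖u‖ * ‖w‖ + √(a ⬝ᵥ a) * √((K *ᵥ b) ⬝ᵥ (K *ᵥ b)) := by
    rw [hae]
    refine (abs_add_le _ _).trans ?_
    rw [abs_neg]
    exact add_le_add h1 h2
  rw [hfit, ← sq_abs]
  refine (pow_le_pow_left₀ (abs_nonneg _) h3 2).trans ?_
  have h4 := Real.sq_sqrt ha0
  have h5 := Real.sq_sqrt hb0
  set p := √(a ⬝ᵥ a)
  set q := √((K *ᵥ b) ⬝ᵥ (K *ᵥ b))
  rw [← h4, ← h5]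
  have h6 : (‖u‖ ^ 2 + σ ^ 2 * p ^ 2) * (‖w‖ ^ 2 + q ^ 2 / σ ^ 2) - (‖u‖ * ‖w‖ + p * q) ^ 2
      = (‖u‖ * q / σ - σ * p * ‖w‖) ^ 2 := by
    field_simp
    ring
  have := sq_nonneg (‖u‖ * q / σ - σ * p * ‖w‖)
  linarith

/-- The error splits into a bias, the feature residual paired with `f`, and a noise term `a ⬝ᵥ e`.
Each is bounded by Cauchy-Schwarz with the common factor `√(postVar)`. -/
theorem abs_postMean_sub_le (hφ : ∀ x y, ⟪φ x, φ y⟫ = k x y) {σ : ℝ} (hσ : 0 < σ) (f : H)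
    (x : Fin n → X) (e y : Fin n → ℝ) (hy : ∀ i, y i = ⟪φ (x i), f⟫ + e i) (z : X) {b : ℝ}
    (hb : 2 * ‖f‖ ^ 2 + 2 * (fitForm (gram k x) (σ ^ 2) e / σ ^ 2) ≤ b) :
    |postMean k σ x y z - ⟪φ z, f⟫| ≤ √b * postStd k σ x z := by
  have hlam : 0 < σ ^ 2 := by positivity
  have hK := posSemidef_gram hφ x
  set a := postWeight k σ x z with ha
  set Q := fitForm (gram k x) (σ ^ 2) e / σ ^ 2 with hQ
  have hQ0 : 0 ≤ Q := div_nonneg (fitForm_nonneg hK hlam e) hlam.le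
  have hvar := postVar_eq hφ hσ x z
  have ha0 : 0 ≤ a ⬝ᵥ a := Finset.sum_nonneg fun i _ => mul_self_nonneg _
  have hV0 : 0 ≤ postVar k σ x z := by
    rw [hvar]
    have := mul_nonneg hlam.le ha0
    positivity
  have hS := Real.sq_sqrt hV0
  have hmean : postMean k σ x y z = a ⬝ᵥ y := by
    have hs : ((gram k x + σ ^ 2 • (1 : Matrix (Fin n) (Fin n) ℝ))⁻¹)ᵀ
        = (gram k x + σ ^ 2 • (1 : Matrix (Fin n) (Fin n) ℝ))⁻¹ := by
      rw [transpose_nonsing_inv,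
        ((isSymm_of_posSemidef hK).add (Matrix.isSymm_one.smul (σ ^ 2))).eq]
    rw [postMean, ha, postWeight, dotProduct_mulVec, ← mulVec_transpose, hs]
  have hdec : postMean k σ x y z - ⟪φ z, f⟫ = ⟪∑ i, a i • φ (x i) - φ z, f⟫ + a ⬝ᵥ e := by
    rw [hmean, inner_sub_left, sum_inner]
    simp only [real_inner_smul_left, dotProduct, hy, mul_add, Finset.sum_add_distrib]
    ring
  have h1 : |⟪∑ i, a i • φ (x i) - φ z, f⟫| ≤ √(postVar k σ x z) * ‖f‖ := by
    refine (abs_real_inner_le_norm _ _).trans (mul_le_mul_of_nonneg_right ?_ (norm_nonneg _))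
    refine Real.le_sqrt_of_sq_le ?_
    rw [hvar]
    have := mul_nonneg hlam.le ha0
    linarith
  have h2 : |a ⬝ᵥ e| ≤ √(postVar k σ x z) * √Q := by
    rw [← Real.sqrt_mul hV0]
    exact Real.abs_le_sqrt (sq_postWeight_dotProduct_le hφ hσ x e z)
  have h3 : ‖f‖ + √Q ≤ √b := by
    refine Real.le_sqrt_of_sq_le ?_
    have := Real.sq_sqrt hQ0
    nlinarith [sq_nonneg (‖f‖ - √Q)]
  rw [hdec, postStd]
  calc _ ≤ √(postVar k σ x z) * ‖f‖ + √(postVar k σ x z) * √Q :=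
        (abs_add_le _ _).trans (add_le_add h1 h2)
    _ = (‖f‖ + √Q) * √(postVar k σ x z) := by ring
    _ ≤ _ := mul_le_mul_of_nonneg_right h3 (Real.sqrt_nonneg _)

end FeatureMap

/-! ### Finiteness and monotonicity of the maximal information gain. -/

section InformationGain

variable {X H : Type*} [NormedAddCommGroup H] [InnerProductSpace ℝ H] {k : X → X → ℝ}
  {φ : X → H} {σ : ℝ}

theorem log_gainDet_gram {n : ℕ} (x : Fin n → X) :
    Real.log (gainDet (gram k x) (σ ^ 2)) = 2 * infoGain k σ x := by
  rw [infoGain, gainDet]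
  ring

/-- Needed because a real supremum over an unbounded set is 0 by convention, so without it
`maxInfoGain` need not dominate the gain of a given sample. -/
theorem bddAbove_infoGain (hφ : ∀ x y, ⟪φ x, φ y⟫ = k x y) (hσ : 0 < σ)
    (hk : BddAbove (Set.range fun x => k x x)) (n : ℕ) :
    BddAbove (Set.range fun x : Fin n → X => infoGain k σ x) := by
  obtain ⟨C, hC⟩ := hk
  refine ⟨n * C / σ ^ 2 / 2, ?_⟩
  rintro _ ⟨x, rfl⟩
  have h := log_gainDet_le_trace (posSemidef_gram hφ x) (show 0 < σ ^ 2 by positivity)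
  rw [log_gainDet_gram] at h
  have htr : (gram k x).trace ≤ n * C := by
    have : (gram k x).trace ≤ ∑ _i : Fin n, C :=
      Finset.sum_le_sum fun i _ => hC ⟨x i, rfl⟩
    simpa using this
  have : (gram k x).trace / σ ^ 2 ≤ n * C / σ ^ 2 := by gcongr
  simp only
  linarith

theorem infoGain_le_maxInfoGain (hφ : ∀ x y, ⟪φ x, φ y⟫ = k x y) (hσ : 0 < σ)
    (hk : BddAbove (Set.range fun x => k x x)) {n : ℕ} (x : Fin n → X) :
    infoGain k σ x ≤ maxInfoGain k σ n :=
  le_ciSup (bddAbove_infoGain hφ hσ hk n) x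

theorem infoGain_nonneg (hφ : ∀ x y, ⟪φ x, φ y⟫ = k x y) (hσ : 0 < σ) {n : ℕ} (x : Fin n → X) :
    0 ≤ infoGain k σ x := by
  have := log_gainDet_nonneg (posSemidef_gram hφ x) (show 0 < σ ^ 2 by positivity)
  rw [log_gainDet_gram] at this
  linarith

theorem infoGain_init_le (hφ : ∀ x y, ⟪φ x, φ y⟫ = k x y) (hσ : 0 < σ) {n : ℕ}
    (x : Fin (n + 1) → X) : infoGain k σ (fun i => x (Fin.castSucc i)) ≤ infoGain k σ x := by
  have hlam : 0 < σ ^ 2 := by positivity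
  have hK := posSemidef_gram hφ x
  have hlead : leading (gram k x) = gram k fun i => x (Fin.castSucc i) := rfl
  have h0 := one_le_gainDet (posSemidef_leading hK) hlam
  have h1 := one_le_gainRatio hK hlam
  have hle : Real.log (gainDet (leading (gram k x)) (σ ^ 2)) ≤
      Real.log (gainDet (gram k x) (σ ^ 2)) := by
    rw [gainDet_succ hK hlam]
    exact Real.log_le_log (by linarith) (le_mul_of_one_le_right (by linarith) h1)
  rw [hlead, log_gainDet_gram, log_gainDet_gram] at hle
  linarith

theorem maxInfoGain_nonneg (hφ : ∀ x y, ⟪φ x, φ y⟫ = k x y) (hσ : 0 < σ) (n : ℕ) :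
    0 ≤ maxInfoGain k σ n :=
  Real.iSup_nonneg fun x => infoGain_nonneg hφ hσ x

theorem maxInfoGain_le_succ [Nonempty X] (hφ : ∀ x y, ⟪φ x, φ y⟫ = k x y) (hσ : 0 < σ)
    (hk : BddAbove (Set.range fun x => k x x)) (n : ℕ) :
    maxInfoGain k σ n ≤ maxInfoGain k σ (n + 1) := by
  refine ciSup_le fun x => ?_
  have h := infoGain_init_le hφ hσ (Fin.snoc x (Classical.arbitrary X) : Fin (n + 1) → X)
  simp only [Fin.snoc_castSucc] at h
  exact h.trans (infoGain_le_maxInfoGain hφ hσ hk _)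

end InformationGain

theorem inner_kerFun_kerFun {X H : Type*} [NormedAddCommGroup H] [InnerProductSpace ℝ H]
    [CompleteSpace H] [RKHS ℝ H X ℝ] (x y : X) :
    ⟪RKHS.kerFun H x (1 : ℝ), RKHS.kerFun H y (1 : ℝ)⟫ = RKHS.kernel H x y 1 := by
  rw [RKHS.kerFun_inner, RKHS.kerFun_apply]
  simp

theorem inner_kerFun_one {X H : Type*} [NormedAddCommGroup H] [InnerProductSpace ℝ H]
    [CompleteSpace H] [RKHS ℝ H X ℝ] (x : X) (f : H) :
    ⟪RKHS.kerFun H x (1 : ℝ), f⟫ = f x := by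
  rw [RKHS.kerFun_inner]
  simp

/-! ### One-step exponential inequality for bounded noise. -/

section Chord

/-- Half the increment of the form `fitForm` caused by the noise `u`, in units of the noise
level. -/
def halfIncr (D p u : ℝ) : ℝ := (u ^ 2 - (u - p) ^ 2 / D) / 2

/-- Slope of the chord of `exp ∘ halfIncr D p` over `[-1, 1]`, normalised by `√D`. -/
def chordSlope (D p : ℝ) : ℝ :=
  (Real.exp (halfIncr D p 1) - Real.exp (halfIncr D p (-1))) / (2 * √D)

variable {D : ℝ} (hD : 1 ≤ D) (p : ℝ)
include hD

/-- The sum equals `2 exp(c) cosh(p/D)`. Using `cosh s ≤ exp(s²/2)` and `D ≥ 1`, the terms in `p`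
cancel favourably, leaving `exp((1 - 1/D)/2) ≤ √D`. -/
theorem exp_halfIncr_add_le :
    Real.exp (halfIncr D p 1) + Real.exp (halfIncr D p (-1)) ≤ 2 * √D := by
  have hD0 : 0 < D := by linarith
  set c := (1 - 1 / D) / 2 - p ^ 2 / (2 * D) with hc
  have h1 : halfIncr D p 1 = c + p / D := by
    rw [halfIncr, hc]
    field_simp
    ring
  have h2 : halfIncr D p (-1) = c + -(p / D) := by
    rw [halfIncr, hc]
    field_simp
    ring
  have hcosh : Real.exp (halfIncr D p 1) + Real.exp (halfIncr D p (-1))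
      = 2 * (Real.exp c * Real.cosh (p / D)) := by
    rw [h1, h2, Real.exp_add, Real.exp_add, Real.cosh_eq]
    ring
  rw [hcosh]
  refine mul_le_mul_of_nonneg_left ?_ (by norm_num)
  have hlog := Real.one_sub_inv_le_log_of_pos hD0
  have hsqrt : √D = Real.exp (Real.log D / 2) := by
    rw [← Real.log_sqrt hD0.le, Real.exp_log (Real.sqrt_pos.mpr hD0)]
  calc _ ≤ Real.exp c * Real.exp ((p / D) ^ 2 / 2) :=
        mul_le_mul_of_nonneg_left (Real.cosh_le_exp_half_sq _) (Real.exp_pos _).le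
    _ = Real.exp (c + (p / D) ^ 2 / 2) := (Real.exp_add _ _).symm
    _ ≤ _ := by
      rw [hsqrt]
      refine Real.exp_le_exp.mpr ?_
      have h3 : (p / D) ^ 2 / 2 ≤ p ^ 2 / (2 * D) := by
        rw [div_pow, div_div]
        refine div_le_div_of_nonneg_left (sq_nonneg p) (by positivity) ?_
        nlinarith
      rw [hc, one_div]
      linarith

theorem abs_chordSlope_le : |chordSlope D p| ≤ 1 := by
  have hD0 : 0 < √D := Real.sqrt_pos.mpr (by linarith)
  have h := exp_halfIncr_add_le hD p
  have h1 := Real.exp_pos (halfIncr D p 1)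
  have h2 := Real.exp_pos (halfIncr D p (-1))
  rw [chordSlope, abs_div, abs_of_pos (show 0 < 2 * √D by positivity),
    div_le_one (by positivity), abs_le]
  constructor <;> linarith

/-- Since `D ≥ 1`, the exponent is convex in `u`, and so is its exponential. The chord over `[-1,
1]` therefore lies above it; the right side replaces its midpoint value by the upper bound 1. -/
theorem exp_halfIncr_le {u : ℝ} (hu : |u| ≤ 1) :
    Real.exp (halfIncr D p u) / √D ≤ 1 + u * chordSlope D p := by
  have hD0 : 0 < √D := Real.sqrt_pos.mpr (by linarith)
  have hD1 : 0 < D := by linarith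
  obtain ⟨hu1, hu2⟩ := abs_le.mp hu
  have hconv : halfIncr D p u ≤
      (1 + u) / 2 * halfIncr D p 1 + (1 - u) / 2 * halfIncr D p (-1) := by
    have : (1 + u) / 2 * halfIncr D p 1 + (1 - u) / 2 * halfIncr D p (-1) - halfIncr D p u
        = (1 - u ^ 2) * (D - 1) / (2 * D) := by
      simp only [halfIncr]
      field_simp
      ring
    have h1 : 0 ≤ (1 - u ^ 2) * (D - 1) / (2 * D) :=
      div_nonneg (mul_nonneg (by nlinarith) (by linarith)) (by positivity)
    linarith
  have hexp := convexOn_exp.2 (Set.mem_univ (halfIncr D p 1)) (Set.mem_univ (halfIncr D p (-1)))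
    (show 0 ≤ (1 + u) / 2 by linarith) (show 0 ≤ (1 - u) / 2 by linarith) (by ring)
  simp only [smul_eq_mul] at hexp
  have h := exp_halfIncr_add_le hD p
  rw [div_le_iff₀ hD0]
  have hs : (1 + u * chordSlope D p) * √D = √D +
      u / 2 * (Real.exp (halfIncr D p 1) - Real.exp (halfIncr D p (-1))) := by
    rw [chordSlope]
    field_simp
  rw [hs]
  have := (Real.exp_le_exp.mpr hconv).trans hexp
  linarith

end Chord

/-! ### The exponential weight and its one-step growth. -/

section MixWeight

/-- The weight `exp (fitForm K lam e / (2 σ²)) / √(gainDet K lam)`: a mixture of exponential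
martingales evaluated at the noise vector `e`. -/
def mixWeight {n : ℕ} (σ : ℝ) (K : Matrix (Fin n) (Fin n) ℝ) (lam : ℝ) (e : Fin n → ℝ) : ℝ :=
  Real.exp (fitForm K lam e / (2 * σ ^ 2)) / √(gainDet K lam)

theorem mixWeight_nonneg {n : ℕ} (σ : ℝ) (K : Matrix (Fin n) (Fin n) ℝ) (lam : ℝ)
    (e : Fin n → ℝ) : 0 ≤ mixWeight σ K lam e := by
  rw [mixWeight]
  positivity

/-- A crude bound, used only for integrability and for the pull-out property of conditional
expectation. -/
theorem mixWeight_le {n : ℕ} {σ : ℝ} (hσ : 0 < σ) {K : Matrix (Fin n) (Fin n) ℝ}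
    (hK : K.PosSemidef) {lam : ℝ} (hlam : 0 < lam) {e : Fin n → ℝ} (he : ∀ i, |e i| ≤ σ) :
    mixWeight σ K lam e ≤ Real.exp (n / 2) := by
  have h1 : 1 ≤ √(gainDet K lam) := Real.one_le_sqrt.mpr (one_le_gainDet hK hlam)
  refine (div_le_self (Real.exp_pos _).le h1).trans (Real.exp_le_exp.mpr ?_)
  have h2 : e ⬝ᵥ e ≤ n * σ ^ 2 := by
    have : e ⬝ᵥ e ≤ ∑ _i : Fin n, σ ^ 2 := by
      refine Finset.sum_le_sum fun i _ => ?_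
      rw [← sq, ← sq_abs]
      exact pow_le_pow_left₀ (abs_nonneg _) (he i) 2
    simpa using this
  have h3 := (fitForm_le_dotProduct hK hlam e).trans h2
  rw [div_le_div_iff₀ (by positivity) (by positivity)]
  linarith

theorem mixWeight_succ_le {n : ℕ} {σ : ℝ} (hσ : 0 < σ)
    {K : Matrix (Fin (n + 1)) (Fin (n + 1)) ℝ} (hK : K.PosSemidef) {lam : ℝ} (hlam : 0 < lam)
    {e : Fin (n + 1) → ℝ} (he : |e (Fin.last n)| ≤ σ) :
    mixWeight σ K lam e ≤ mixWeight σ (leading K) lam (Fin.init e) *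
      (1 + e (Fin.last n) / σ *
        chordSlope (gainRatio K lam) (lastPred K lam (Fin.init e) / σ)) := by
  have hD := one_le_gainRatio hK hlam
  have hG := one_le_gainDet (posSemidef_leading hK) hlam
  have hu : |e (Fin.last n) / σ| ≤ 1 := by
    rw [abs_div, abs_of_pos hσ, div_le_one hσ]
    exact he
  have hfit : fitForm K lam e / (2 * σ ^ 2)
      = fitForm (leading K) lam (Fin.init e) / (2 * σ ^ 2) +
        halfIncr (gainRatio K lam) (lastPred K lam (Fin.init e) / σ) (e (Fin.last n) / σ) := by
    rw [fitForm_succ hK hlam, halfIncr]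
    have : gainRatio K lam ≠ 0 := by linarith
    field_simp
  have hsplit : mixWeight σ K lam e = mixWeight σ (leading K) lam (Fin.init e) *
      (Real.exp (halfIncr (gainRatio K lam) (lastPred K lam (Fin.init e) / σ)
        (e (Fin.last n) / σ)) / √(gainRatio K lam)) := by
    rw [mixWeight, mixWeight, hfit, gainDet_succ hK hlam, Real.exp_add,
      Real.sqrt_mul (by linarith), mul_div_mul_comm]
  rw [hsplit]
  exact mul_le_mul_of_nonneg_left (exp_halfIncr_le hD _ hu) (mixWeight_nonneg ..)

end MixWeight

/-! ### Measurability of the matrix expressions. -/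

section Measurability

variable {Ω : Type*} {mΩ : MeasurableSpace Ω} {n : ℕ}

theorem measurable_det {M : Ω → Matrix (Fin n) (Fin n) ℝ}
    (hM : ∀ i j, Measurable fun ω => M ω i j) : Measurable fun ω => (M ω).det := by
  simp only [Matrix.det_apply']
  exact Finset.measurable_sum _ fun τ _ =>
    (Finset.measurable_prod _ fun i _ => hM _ _).const_mul _

theorem measurable_inv_apply {M : Ω → Matrix (Fin n) (Fin n) ℝ}
    (hM : ∀ i j, Measurable fun ω => M ω i j) (i j : Fin n) :
    Measurable fun ω => (M ω)⁻¹ i j := by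
  simp only [Matrix.inv_def, Ring.inverse_eq_inv', Matrix.smul_apply, smul_eq_mul,
    Matrix.adjugate_apply]
  refine (measurable_det hM).inv.mul (measurable_det fun a b => ?_)
  by_cases h : a = j
  · subst h
    simp
  · simpa [Matrix.updateRow_ne h] using hM a b

theorem measurable_dotProduct {u v : Ω → Fin n → ℝ} (hu : ∀ i, Measurable fun ω => u ω i)
    (hv : ∀ i, Measurable fun ω => v ω i) : Measurable fun ω => u ω ⬝ᵥ v ω :=
  Finset.measurable_sum _ fun i _ => (hu i).mul (hv i)

theorem measurable_mulVec_apply {M : Ω → Matrix (Fin n) (Fin n) ℝ} {v : Ω → Fin n → ℝ}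
    (hM : ∀ i j, Measurable fun ω => M ω i j) (hv : ∀ i, Measurable fun ω => v ω i) (i : Fin n) :
    Measurable fun ω => (M ω *ᵥ v ω) i :=
  measurable_dotProduct (hM i) hv

theorem measurable_add_smul_one_inv_apply {K : Ω → Matrix (Fin n) (Fin n) ℝ}
    (hK : ∀ i j, Measurable fun ω => K ω i j) (lam : ℝ) (i j : Fin n) :
    Measurable fun ω => (K ω + lam • (1 : Matrix (Fin n) (Fin n) ℝ))⁻¹ i j :=
  measurable_inv_apply (fun a b => (hK a b).add_const _) i j

theorem measurable_mixWeight {K : Ω → Matrix (Fin n) (Fin n) ℝ} {e : Ω → Fin n → ℝ}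
    (hK : ∀ i j, Measurable fun ω => K ω i j) (he : ∀ i, Measurable fun ω => e ω i) (σ lam : ℝ) :
    Measurable fun ω => mixWeight σ (K ω) lam (e ω) := by
  have hfit : Measurable fun ω => fitForm (K ω) lam (e ω) :=
    (measurable_dotProduct he he).sub ((measurable_dotProduct he
      (measurable_mulVec_apply (measurable_add_smul_one_inv_apply hK lam) he)).const_mul _)
  have hdet : Measurable fun ω => gainDet (K ω) lam :=
    measurable_det fun i j => ((hK i j).const_mul _).const_add _
  exact (hfit.div_const _).exp.div hdet.sqrt

theorem measurable_chordSlope {K : Ω → Matrix (Fin (n + 1)) (Fin (n + 1)) ℝ} {e : Ω → Fin n → ℝ}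
    (hK : ∀ i j, Measurable fun ω => K ω i j) (he : ∀ i, Measurable fun ω => e ω i) (σ lam : ℝ) :
    Measurable fun ω => chordSlope (gainRatio (K ω) lam) (lastPred (K ω) lam (e ω) / σ) := by
  have hinv := measurable_add_smul_one_inv_apply (K := fun ω => leading (K ω))
    (fun i j => hK i.castSucc j.castSucc) lam
  have hcol : ∀ i, Measurable fun ω => lastCol (K ω) i := fun i => hK i.castSucc (Fin.last n)
  have hD : Measurable fun ω => gainRatio (K ω) lam :=
    (((hK _ _).add_const _).sub
      (measurable_dotProduct hcol (measurable_mulVec_apply hinv hcol))).div_const _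
  have hp : Measurable fun ω => lastPred (K ω) lam (e ω) / σ :=
    (measurable_dotProduct hcol (measurable_mulVec_apply hinv he)).div_const _
  have hincr : ∀ u : ℝ, Measurable fun ω =>
      halfIncr (gainRatio (K ω) lam) (lastPred (K ω) lam (e ω) / σ) u := fun u =>
    ((((hp.const_sub u).pow_const 2).div hD).const_sub _).div_const _
  exact ((hincr 1).exp.sub (hincr (-1)).exp).div (hD.sqrt.const_mul _)

end Measurability

theorem integral_mul_eq_zero_of_condExp {Ω : Type*} {m m₀ : MeasurableSpace Ω} {P : Measure Ω}
    [IsProbabilityMeasure P] (hm : m ≤ m₀) {g ξ : Ω → ℝ} {C : ℝ} (hg : Measurable[m] g)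
    (hgC : ∀ᵐ ω ∂P, |g ω| ≤ C) (hξ : Integrable ξ P) (hmean : P[ξ | m] =ᵐ[P] 0) :
    ∫ ω, g ω * ξ ω ∂P = 0 := by
  have hgs : StronglyMeasurable[m] g := hg.stronglyMeasurable
  have h := condExp_stronglyMeasurable_mul_of_bound hm hgs hξ C hgC
  have h0 : P[g * ξ | m] =ᵐ[P] 0 := by
    filter_upwards [h, hmean] with ω h1 h2
    rw [h1, Pi.mul_apply, h2]
    simp
  calc ∫ ω, g ω * ξ ω ∂P = ∫ ω, (P[g * ξ | m]) ω ∂P := (integral_condExp hm).symm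
    _ = 0 := by rw [integral_congr_ae h0]; simp

/-! ### The weight has expectation at most one. -/

section Observations

variable {X Ω : Type*} [MeasurableSpace X] {m : MeasurableSpace Ω} {P : Measure Ω}
  {ℱ : Filtration ℕ m} {x : ℕ → Ω → X} {ε : ℕ → Ω → ℝ} {T : ℕ} {σ : ℝ}
  {k : X → X → ℝ}

/-- The slack `n ≤ s + 1` expresses predictability: the next query point is already known when its
noise is drawn. -/
theorem measurable_gram_firstTerms (hk : Measurable (Function.uncurry k))
    (hx : ∀ t < T, Measurable[ℱ t] (x (t + 1))) {n s : ℕ} (hn : n ≤ T) (hs : n ≤ s + 1)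
    (i j : Fin n) : Measurable[ℱ s] fun ω => gram k (firstTerms (fun t => x t ω) n) i j := by
  have h : ∀ i : Fin n, Measurable[ℱ s] (x (i + 1)) := fun i =>
    (hx i (by omega)).mono (ℱ.mono (by omega)) le_rfl
  exact hk.comp ((h i).prodMk (h j))

theorem measurable_firstTerms_noise (hε : ∀ t < T, Measurable[ℱ (t + 1)] (ε (t + 1)))
    {n : ℕ} (hn : n ≤ T) (i : Fin n) :
    Measurable[ℱ n] fun ω => firstTerms (fun t => ε t ω) n i :=
  (hε i (by omega)).mono (ℱ.mono (by omega)) le_rfl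

theorem ae_forall_firstTerms_le (hε_bdd : ∀ t < T, ∀ᵐ ω ∂P, |ε (t + 1) ω| ≤ σ) {n : ℕ}
    (hn : n ≤ T) : ∀ᵐ ω ∂P, ∀ i, |firstTerms (fun t => ε t ω) n i| ≤ σ :=
  ae_all_iff.mpr fun i => hε_bdd i (by omega)

/-- Induction on `n` with `lam` fixed: the one-step bound is affine in the new noise, with a
predictable bounded coefficient, so the linear term integrates to zero. -/
theorem integral_mixWeight_le_one [IsProbabilityMeasure P] (hσ : 0 < σ)
    (hk : Measurable (Function.uncurry k))
    (hpsd : ∀ (n : ℕ) (z : Fin n → X), (gram k z).PosSemidef)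
    (hx : ∀ t < T, Measurable[ℱ t] (x (t + 1)))
    (hε : ∀ t < T, Measurable[ℱ (t + 1)] (ε (t + 1)))
    (hε_mean : ∀ t < T, P[ε (t + 1) | ℱ t] =ᵐ[P] 0)
    (hε_bdd : ∀ t < T, ∀ᵐ ω ∂P, |ε (t + 1) ω| ≤ σ) {lam : ℝ} (hlam : 0 < lam) {n : ℕ}
    (hn : n ≤ T) :
    Integrable (fun ω => mixWeight σ (gram k (firstTerms (fun t => x t ω) n)) lam
      (firstTerms (fun t => ε t ω) n)) P ∧
    ∫ ω, mixWeight σ (gram k (firstTerms (fun t => x t ω) n)) lam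
      (firstTerms (fun t => ε t ω) n) ∂P ≤ 1 := by
  have hint : ∀ n ≤ T, Integrable (fun ω => mixWeight σ (gram k (firstTerms (fun t => x t ω) n))
      lam (firstTerms (fun t => ε t ω) n)) P := by
    intro n hn
    have hmeas : Measurable[ℱ n] fun ω => mixWeight σ (gram k (firstTerms (fun t => x t ω) n))
        lam (firstTerms (fun t => ε t ω) n) :=
      measurable_mixWeight (measurable_gram_firstTerms hk hx hn (by omega))
        (measurable_firstTerms_noise hε hn) σ lam
    refine Integrable.of_bound (hmeas.mono (ℱ.le n) le_rfl).aestronglyMeasurable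
      (Real.exp (n / 2)) ?_
    filter_upwards [ae_forall_firstTerms_le hε_bdd hn] with ω hω
    rw [Real.norm_of_nonneg (mixWeight_nonneg ..)]
    exact mixWeight_le hσ (hpsd _ _) hlam hω
  refine ⟨hint n hn, ?_⟩
  induction n with
  | zero => simp [mixWeight, fitForm, gainDet]
  | succ n ih =>
    have hn' : n ≤ T := by omega
    set W : Ω → ℝ := fun ω => mixWeight σ (gram k (firstTerms (fun t => x t ω) n)) lam
      (firstTerms (fun t => ε t ω) n) with hW
    -- The coefficient of the new noise; it is `ℱ n`-measurable although it involves the point of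
    -- index `n + 1`.
    set g : Ω → ℝ := fun ω => W ω * (chordSlope
      (gainRatio (gram k (firstTerms (fun t => x t ω) (n + 1))) lam)
      (lastPred (gram k (firstTerms (fun t => x t ω) (n + 1))) lam
        (firstTerms (fun t => ε t ω) n) / σ) / σ) with hg
    have hWmeas : Measurable[ℱ n] W :=
      measurable_mixWeight (measurable_gram_firstTerms hk hx hn' (by omega))
        (measurable_firstTerms_noise hε hn') σ lam
    have hgmeas : Measurable[ℱ n] g :=
      hWmeas.mul ((measurable_chordSlope (measurable_gram_firstTerms hk hx hn le_rfl)
        (measurable_firstTerms_noise hε hn') σ lam).div_const σ)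
    have hgbdd : ∀ᵐ ω ∂P, |g ω| ≤ Real.exp (n / 2) * (1 / σ) := by
      filter_upwards [ae_forall_firstTerms_le hε_bdd hn'] with ω hω
      rw [hg]
      simp only
      rw [abs_mul, abs_div, abs_of_pos hσ, abs_of_nonneg (mixWeight_nonneg ..)]
      refine mul_le_mul (mixWeight_le hσ (hpsd _ _) hlam hω) ?_ (by positivity)
        (Real.exp_pos _).le
      exact div_le_div_of_nonneg_right
        (abs_chordSlope_le (one_le_gainRatio (hpsd _ _) hlam) _) hσ.le
    have hεmeas : Measurable (ε (n + 1)) := (hε n (by omega)).mono (ℱ.le _) le_rfl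
    have hεint : Integrable (ε (n + 1)) P :=
      Integrable.of_bound hεmeas.aestronglyMeasurable σ (hε_bdd n (by omega))
    have hzero := integral_mul_eq_zero_of_condExp (ℱ.le n) hgmeas hgbdd hεint
      (hε_mean n (by omega))
    have hgint : Integrable (fun ω => g ω * ε (n + 1) ω) P :=
      hεint.bdd_mul (hgmeas.mono (ℱ.le n) le_rfl).aestronglyMeasurable hgbdd
    calc _ ≤ ∫ ω, (W ω + g ω * ε (n + 1) ω) ∂P := by
          refine integral_mono_ae (hint (n + 1) hn) ((hint n hn').add hgint) ?_
          filter_upwards [hε_bdd n (by omega)] with ω hω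
          refine (mixWeight_succ_le hσ (hpsd _ _) hlam
            (e := firstTerms (fun t => ε t ω) (n + 1)) hω).trans_eq ?_
          change W ω * (1 + ε (n + 1) ω / σ * _) = W ω + W ω * (_ / σ) * ε (n + 1) ω
          ring_nf
          rfl
      _ = ∫ ω, W ω ∂P := by rw [integral_add (hint n hn') hgint, hzero, add_zero]
      _ ≤ 1 := ih hn'

end Observations

/-! ### Choice of the regularisation and the cubic bound. -/

/-- The regularisation parameter at which the concentration inequality is applied when the
information gain is at most `η`. -/
def regParam (σ η : ℝ) : ℝ := if η = 0 then σ ^ 2 else σ ^ 2 * min 1 η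

theorem regParam_pos {σ η : ℝ} (hσ : 0 < σ) (hη : 0 ≤ η) : 0 < regParam σ η := by
  rw [regParam]
  split_ifs with h
  · positivity
  · have : 0 < η := lt_of_le_of_ne hη (Ne.symm h)
    positivity

theorem fitForm_le_of_mixWeight_lt {n : ℕ} {σ : ℝ} (hσ : 0 < σ) {K : Matrix (Fin n) (Fin n) ℝ}
    (hK : K.PosSemidef) {lam : ℝ} (hlam : 0 < lam) {e : Fin n → ℝ} {R : ℝ}
    (hR : mixWeight σ K lam e < R) :
    fitForm K lam e / σ ^ 2 ≤ 2 * Real.log R + Real.log (gainDet K lam) := by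
  have hG : 0 < gainDet K lam := by linarith [one_le_gainDet hK hlam]
  have hs : 0 < √(gainDet K lam) := Real.sqrt_pos.mpr hG
  have hR0 : 0 < R := (mixWeight_nonneg σ K lam e).trans_lt hR
  rw [mixWeight, div_lt_iff₀ hs] at hR
  have h := Real.log_le_log (Real.exp_pos _) hR.le
  rw [Real.log_exp, Real.log_mul hR0.ne' hs.ne', Real.log_sqrt hG.le] at h
  have : fitForm K lam e / σ ^ 2 = 2 * (fitForm K lam e / (2 * σ ^ 2)) := by field_simp
  linarith

/-- For `η ≥ 1` the bound `4L + 2η` is at most `η(4L + 2)`. For `0 < η < 1` the parameter `σ² η`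
gives `3η(4L + 2)`. Both are at most `η(6 + 12L)`. For `η = 0` the energy itself vanishes. -/
theorem fitForm_le_cube {n : ℕ} {σ : ℝ} (hσ : 0 < σ) {K : Matrix (Fin n) (Fin n) ℝ}
    (hK : K.PosSemidef) {e : Fin n → ℝ} {η R L : ℝ} (hη : 0 ≤ η)
    (hdet : Real.log (gainDet K (σ ^ 2)) ≤ 2 * η) (hL : 69 / 100 ≤ L)
    (hRL : Real.log R ≤ 2 * L) (hR : mixWeight σ K (regParam σ η) e < R) :
    fitForm K (σ ^ 2) e / σ ^ 2 ≤ 150 * η * L ^ 3 := by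
  have hlam : 0 < σ ^ 2 := by positivity
  -- The only use of `L ≥ 0.69`, a lower bound for `log 2`: it lets the cube absorb the affine term.
  have hcube : 6 + 12 * L ≤ 150 * L ^ 3 := by
    have : 0 ≤ L * (L ^ 2 - (69 / 100) ^ 2) :=
      mul_nonneg (by linarith) (by nlinarith)
    nlinarith
  have hηcube : η * (6 + 12 * L) ≤ 150 * η * L ^ 3 := by
    have := mul_le_mul_of_nonneg_left hcube hη
    linarith
  have h := fitForm_le_of_mixWeight_lt hσ hK (regParam_pos hσ hη) hR
  rcases hη.eq_or_lt with h0 | h0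
  · have h1 := fitForm_le_dotProduct_mul_log hK hlam e
    have h2 : 0 ≤ e ⬝ᵥ e := Finset.sum_nonneg fun i _ => mul_self_nonneg _
    have h3 : fitForm K (σ ^ 2) e ≤ 0 :=
      h1.trans (mul_nonpos_of_nonpos_of_nonneg (by linarith) h2)
    rw [← h0]
    simpa using div_nonpos_of_nonpos_of_nonneg h3 hlam.le
  rw [regParam, if_neg h0.ne'] at h
  rcases le_total 1 η with h1 | h1
  · rw [min_eq_left h1, mul_one] at h
    nlinarith
  · rw [min_eq_right h1] at h
    have h2 := log_gainDet_mul_le hK hlam h0 h1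
    have h3 : Real.log (gainDet K (σ ^ 2)) / η ≤ 2 := by
      rw [div_le_iff₀ h0]
      exact hdet
    have h4 : fitForm K (σ ^ 2) e / σ ^ 2 ≤ 3 * η * (fitForm K (σ ^ 2 * η) e / σ ^ 2) := by
      rw [← mul_div_assoc]
      exact div_le_div_of_nonneg_right (fitForm_le_mul_fitForm hK hlam h0 hdet e) hlam.le
    have h5 : fitForm K (σ ^ 2 * η) e / σ ^ 2 ≤ 4 * L + 2 := by linarith
    have h6 := mul_le_mul_of_nonneg_left h5 (show 0 ≤ 3 * η by positivity)
    linarith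

/-- For one observation with noise at most `σ`, the energy is at most `2η`, and `150 (1/4)³ > 2`. No
probability is spent. -/
theorem fitForm_le_of_one {σ : ℝ} (hσ : 0 < σ) {K : Matrix (Fin 1) (Fin 1) ℝ}
    (hK : K.PosSemidef) {e : Fin 1 → ℝ} (he : |e 0| ≤ σ) {η L : ℝ} (hη : 0 ≤ η)
    (hdet : Real.log (gainDet K (σ ^ 2)) ≤ 2 * η) (hL : 1 / 4 ≤ L) :
    fitForm K (σ ^ 2) e / σ ^ 2 ≤ 150 * η * L ^ 3 := by
  have hlam : 0 < σ ^ 2 := by positivity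
  have hee : e ⬝ᵥ e ≤ σ ^ 2 := by
    have : e ⬝ᵥ e = |e 0| ^ 2 := by simp [dotProduct, sq]
    rw [this]
    exact pow_le_pow_left₀ (abs_nonneg _) he 2
  have h1 := (fitForm_le_dotProduct_mul_log hK hlam e).trans
    (mul_le_mul_of_nonneg_left hee (log_gainDet_nonneg hK hlam))
  rw [← div_le_iff₀ hlam] at h1
  have h2 : (1 / 4 : ℝ) ^ 3 ≤ L ^ 3 := pow_le_pow_left₀ (by norm_num) hL 3
  have h3 := mul_le_mul_of_nonneg_left h2 (show 0 ≤ 150 * η by positivity)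
  linarith

/-! ### Elementary bounds for the logarithm. -/

section LogBounds

variable {δ : ℝ} (hδ : δ ∈ Set.Ioo (0 : ℝ) 1)
include hδ

theorem log_div_nonneg {t : ℕ} (ht : 1 ≤ t) : 0 ≤ Real.log (t / δ) := by
  refine Real.log_nonneg ?_
  have : (1 : ℝ) ≤ t := by exact_mod_cast ht
  rw [one_le_div hδ.1]
  linarith [hδ.2]

theorem le_log_div {t : ℕ} (ht : 2 ≤ t) : 69 / 100 ≤ Real.log (t / δ) := by
  have h2 : (2 : ℝ) ≤ t := by exact_mod_cast ht
  have h : (2 : ℝ) ≤ t / δ := by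
    rw [le_div_iff₀ hδ.1]
    nlinarith [hδ.1, hδ.2]
  have := Real.log_le_log (by norm_num) h
  linarith [Real.log_two_gt_d9]

theorem log_sq_div_le {t : ℕ} (ht : 1 ≤ t) : Real.log ((t : ℝ) ^ 2 / δ) ≤ 2 * Real.log (t / δ) := by
  have h0 : (t : ℝ) ≠ 0 := by positivity
  rw [Real.log_div (by positivity) hδ.1.ne', Real.log_div h0 hδ.1.ne', Real.log_pow]
  have := Real.log_nonpos hδ.1.le hδ.2.le
  push_cast
  linarith

theorem log_div_le_succ {t : ℕ} (ht : 1 ≤ t) :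
    Real.log (t / δ) ≤ Real.log ((t + 1 : ℕ) / δ) := by
  have h0 : (0 : ℝ) < t := by exact_mod_cast ht
  refine Real.log_le_log (div_pos h0 hδ.1) (div_le_div_of_nonneg_right ?_ hδ.1.le)
  push_cast
  linarith

end LogBounds

theorem quarter_le_log_inv {δ : ℝ} (h0 : 0 < δ) (h : δ ≤ 3 / 4) :
    1 / 4 ≤ Real.log ((1 : ℕ) / δ) := by
  have h1 := Real.one_sub_inv_le_log_of_pos (show 0 < ((1 : ℕ) : ℝ) / δ by positivity)
  have h2 : (((1 : ℕ) : ℝ) / δ)⁻¹ = δ := by simp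
  rw [h2] at h1
  linarith

/-- A union bound over the times `2, …, T` with failure probabilities `δ / t ^ 2`. -/
theorem exists_event {Ω : Type*} {m : MeasurableSpace Ω} {P : Measure Ω} [IsProbabilityMeasure P]
    {δ : ℝ} (hδ : 0 < δ) {T : ℕ} {W : ℕ → Ω → ℝ} (hWm : ∀ t ≤ T, Measurable (W t))
    (hW0 : ∀ t ω, 0 ≤ W t ω) (hWi : ∀ t ≤ T, Integrable (W t) P)
    (hW1 : ∀ t ≤ T, ∫ ω, W t ω ∂P ≤ 1) {B : Set Ω} (hB : MeasurableSet B)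
    (hBae : ∀ᵐ ω ∂P, ω ∈ B) :
    ∃ A : Set Ω, MeasurableSet A ∧ 1 - δ ≤ P.real A ∧
      ∀ ω ∈ A, ω ∈ B ∧ ∀ t ≤ T, 2 ≤ t → W t ω < (t : ℝ) ^ 2 / δ := by
  set bad : ℕ → Set Ω := fun t => {ω | (t : ℝ) ^ 2 / δ ≤ W t ω} with hbad
  set N : Set Ω := Bᶜ ∪ ⋃ t ∈ Finset.Ioc 1 T, bad t with hN
  have hNmeas : MeasurableSet N := hB.compl.union <|
    Finset.measurableSet_biUnion _ fun t ht =>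
      measurableSet_le measurable_const (hWm t (Finset.mem_Ioc.mp ht).2)
  refine ⟨Nᶜ, hNmeas.compl, ?_, fun ω hω => ?_⟩
  · have hbadP : ∀ t ∈ Finset.Ioc 1 T, P.real (bad t) ≤ δ * ((t : ℝ) ^ 2)⁻¹ := by
      intro t ht
      obtain ⟨h1, h2⟩ := Finset.mem_Ioc.mp ht
      have ht0 : (0 : ℝ) < t := by exact_mod_cast (by omega : 0 < t)
      have h := (mul_meas_ge_le_integral_of_nonneg (.of_forall (hW0 t)) (hWi t h2)
        ((t : ℝ) ^ 2 / δ)).trans (hW1 t h2)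
      have hpos : 0 < (t : ℝ) ^ 2 / δ := by positivity
      rw [mul_comm, ← le_div_iff₀ hpos] at h
      refine h.trans_eq ?_
      field_simp
    -- The sum starts at `t = 2`, so telescoping bounds it by `1 - 1/T` and the total failure
    -- probability is at most `δ`.
    have hsum : ∑ t ∈ Finset.Ioc 1 T, ((t : ℝ) ^ 2)⁻¹ ≤ 1 := by
      rcases Nat.eq_zero_or_pos T with h | h
      · simp [h]
      · have h1 := sum_Ioc_inv_sq_le_sub (α := ℝ) (k := 1) (n := T) one_ne_zero h
        have h2 : (0 : ℝ) ≤ (T : ℝ)⁻¹ := by positivity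
        simp only [Nat.cast_one, inv_one] at h1
        linarith
    have hBc : P.real Bᶜ = 0 := by
      rw [measureReal_def, show P Bᶜ = 0 from hBae, ENNReal.toReal_zero]
    have hNP : P.real N ≤ δ := calc
      P.real N ≤ P.real Bᶜ + P.real (⋃ t ∈ Finset.Ioc 1 T, bad t) := measureReal_union_le _ _
      _ ≤ 0 + ∑ t ∈ Finset.Ioc 1 T, P.real (bad t) :=
        add_le_add hBc.le (measureReal_biUnion_finset_le _ _)
      _ ≤ ∑ t ∈ Finset.Ioc 1 T, δ * ((t : ℝ) ^ 2)⁻¹ := by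
        rw [zero_add]
        exact Finset.sum_le_sum hbadP
      _ = δ * ∑ t ∈ Finset.Ioc 1 T, ((t : ℝ) ^ 2)⁻¹ := by rw [Finset.mul_sum]
      _ ≤ δ := by nlinarith
    rw [probReal_compl_eq_one_sub hNmeas]
    linarith
  · rw [hN, Set.mem_compl_iff, Set.mem_union, not_or] at hω
    refine ⟨not_not.mp hω.1, fun t ht h2 => not_le.mp fun h => hω.2 ?_⟩
    exact Set.mem_biUnion (Finset.mem_coe.mpr (Finset.mem_Ioc.mpr ⟨by omega, ht⟩)) h

end GPUCB

end

/-! ### Assembly of the confidence bounds. -/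

theorem mainTheorem3
    -- the domain, and the reproducing kernel Hilbert space `H` of the bounded kernel `k`
    {X : Type*} [MeasurableSpace X]
    {H : Type*} [NormedAddCommGroup H] [InnerProductSpace ℝ H] [CompleteSpace H] [RKHS ℝ H X ℝ]
    (k : X → X → ℝ) (hkH : ∀ x y, RKHS.kernel H x y 1 = k x y)
    (hk_meas : Measurable (Function.uncurry k))
    (hk_bdd : BddAbove (Set.range fun x => k x x))
    -- the unknown function, the noise level, the confidence level, the horizon
    (f : H) (σ : ℝ) (hσ : 0 < σ) (δ : ℝ) (hδ : δ ∈ Set.Ioo (0 : ℝ) 1) (T : ℕ)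
    -- query points `x 1, …, x T`, chosen from the past and possibly additional randomness, and
    -- noise `ε 1, …, ε T`: a martingale difference sequence bounded by `σ`
    {Ω : Type*} {m : MeasurableSpace Ω} (P : Measure Ω) [IsProbabilityMeasure P]
    (ℱ : Filtration ℕ m) (x : ℕ → Ω → X) (ε : ℕ → Ω → ℝ)
    (hx : ∀ t < T, Measurable[ℱ t] (x (t + 1)))
    (hε : ∀ t < T, Measurable[ℱ (t + 1)] (ε (t + 1)))
    (hε_mean : ∀ t < T, P[ε (t + 1) | ℱ t] =ᵐ[P] 0)
    (hε_bdd : ∀ t < T, ∀ᵐ ω ∂P, |ε (t + 1) ω| ≤ σ)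
    -- the observations
    (y : ℕ → Ω → ℝ) (hy : ∀ t < T, ∀ ω, y (t + 1) ω = f (x (t + 1) ω) + ε (t + 1) ω)
    (β : ℕ → ℝ)
    (hβ : ∀ t, 1 ≤ t →
      2 * ‖f‖ ^ 2 + 300 * GPUCB.maxInfoGain k σ t * Real.log (t / δ) ^ 3 ≤ β t) :
    ∃ A : Set Ω, MeasurableSet A ∧ 1 - δ ≤ P.real A ∧ ∀ ω ∈ A, ∀ z : X, ∀ t ≤ T,
      (1 ≤ t → (2 ≤ t ∨ δ ≤ 3 / 4) →
        |GPUCB.postMean k σ (GPUCB.firstTerms (fun s => x s ω) t)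
            (GPUCB.firstTerms (fun s => y s ω) t) z - f z| ≤
          √(β t) * GPUCB.postStd k σ (GPUCB.firstTerms (fun s => x s ω) t) z) ∧
      |GPUCB.postMean k σ (GPUCB.firstTerms (fun s => x s ω) t)
          (GPUCB.firstTerms (fun s => y s ω) t) z - f z| ≤
        √(β (t + 1)) * GPUCB.postStd k σ (GPUCB.firstTerms (fun s => x s ω) t) z := by
  set φ : X → H := fun x => RKHS.kerFun H x (1 : ℝ) with hφdef
  have hφ : ∀ x y, inner ℝ (φ x) (φ y) = k x y := fun x y => by
    rw [← hkH]
    exact GPUCB.inner_kerFun_kerFun x y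
  have hf : ∀ z, f z = inner ℝ (φ z) f := fun z => (GPUCB.inner_kerFun_one z f).symm
  have hpsd : ∀ (n : ℕ) (z : Fin n → X), (GPUCB.gram k z).PosSemidef := fun n z =>
    GPUCB.posSemidef_gram hφ z
  -- Monotonicity of the maximal gain appends an arbitrary point to a sample, so a point must exist.
  have : Nonempty X := (nonempty_of_isProbabilityMeasure P).map (x 0)
  set η : ℕ → ℝ := GPUCB.maxInfoGain k σ with hη
  have hη0 : ∀ t, 0 ≤ η t := GPUCB.maxInfoGain_nonneg hφ hσ
  have hηs : ∀ t, η t ≤ η (t + 1) := GPUCB.maxInfoGain_le_succ hφ hσ hk_bdd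
  have hdet : ∀ {t : ℕ} (z : Fin t → X),
      Real.log (GPUCB.gainDet (GPUCB.gram k z) (σ ^ 2)) ≤ 2 * η t := fun z => by
    rw [GPUCB.log_gainDet_gram]
    exact mul_le_mul_of_nonneg_left (GPUCB.infoGain_le_maxInfoGain hφ hσ hk_bdd z) two_pos.le
  have hW : ∀ t ≤ T, _ := fun t ht => GPUCB.integral_mixWeight_le_one hσ hk_meas hpsd hx hε hε_mean
    hε_bdd (GPUCB.regParam_pos hσ (hη0 t)) ht
  have hεm : ∀ t < T, Measurable (ε (t + 1)) := fun t ht => (hε t ht).mono (ℱ.le _) le_rfl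
  -- The regularisation varies with `t`, but through the maximal gain rather than the random one.
  -- Each `W t` is thus the time-`t` value of a process with deterministic `lam`.
  obtain ⟨A, hA, hPA, hAω⟩ := GPUCB.exists_event (P := P) hδ.1
    (W := fun t ω => GPUCB.mixWeight σ (GPUCB.gram k (GPUCB.firstTerms (fun s => x s ω) t))
      (GPUCB.regParam σ (η t)) (GPUCB.firstTerms (fun s => ε s ω) t))
    (fun t ht => (GPUCB.measurable_mixWeight
      (GPUCB.measurable_gram_firstTerms hk_meas hx ht (Nat.le_succ t))
      (GPUCB.measurable_firstTerms_noise hε ht) σ _).mono (ℱ.le t) le_rfl)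
    (fun t ω => GPUCB.mixWeight_nonneg ..) (fun t ht => (hW t ht).1) (fun t ht => (hW t ht).2)
    (B := ⋂ t ∈ Finset.range T, {ω | |ε (t + 1) ω| ≤ σ})
    (Finset.measurableSet_biInter _ fun t ht =>
      measurableSet_le (hεm t (Finset.mem_range.mp ht)).abs measurable_const)
    (by
      simp only [Set.mem_iInter, Finset.mem_range, Set.mem_ofPred_eq]
      refine ae_all_iff.mpr fun t => ?_
      by_cases ht : t < T
      · filter_upwards [hε_bdd t ht] with ω h _ using h
      · exact .of_forall fun ω h => absurd h ht)
  refine ⟨A, hA, hPA, fun ω hω z t ht => ?_⟩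
  obtain ⟨hBω, hWω⟩ := hAω ω hω
  simp only [Set.mem_iInter, Finset.mem_range, Set.mem_ofPred_eq] at hBω
  set xs : Fin t → X := GPUCB.firstTerms (fun s => x s ω) t with hxs
  set es : Fin t → ℝ := GPUCB.firstTerms (fun s => ε s ω) t with hes
  have hys : ∀ i, GPUCB.firstTerms (fun s => y s ω) t i = inner ℝ (φ (xs i)) f + es i := fun i => by
    rw [← hf]
    exact hy i (by omega) ω
  set Q := GPUCB.fitForm (GPUCB.gram k xs) (σ ^ 2) es / σ ^ 2 with hQ
  have hconf : ∀ s, 1 ≤ s → Q ≤ 150 * η s * Real.log (s / δ) ^ 3 →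
      |GPUCB.postMean k σ xs (GPUCB.firstTerms (fun s => y s ω) t) z - f z| ≤
        √(β s) * GPUCB.postStd k σ xs z := fun s hs h => by
    rw [hf]
    refine GPUCB.abs_postMean_sub_le hφ hσ f xs es _ hys z (le_trans ?_ (hβ s hs))
    linarith
  have hone : ∀ L : ℝ, t = 1 → 1 / 4 ≤ L → Q ≤ 150 * η 1 * L ^ 3 := fun L h1 hL => by
    subst h1
    exact GPUCB.fitForm_le_of_one hσ (hpsd _ _) (hBω 0 (by omega)) (hη0 1) (hdet xs) hL
  have htwo : 2 ≤ t → Q ≤ 150 * η t * Real.log (t / δ) ^ 3 := fun h2 =>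
    GPUCB.fitForm_le_cube hσ (hpsd _ _) (hη0 t) (hdet xs) (GPUCB.le_log_div hδ h2)
      (GPUCB.log_sq_div_le hδ (by omega)) (hWω t ht h2)
  refine ⟨fun h1 h => hconf t h1 ?_, hconf (t + 1) (by omega) ?_⟩
  · rcases Nat.lt_or_ge t 2 with h2 | h2
    · obtain rfl : t = 1 := by omega
      exact hone _ rfl (GPUCB.quarter_le_log_inv hδ.1 (h.resolve_left (by omega)))
    · exact htwo h2
  -- Part (ii) follows from monotonicity of the gain and of the logarithm. At `t = 0` the energy is
  -- zero, and at `t = 1` the larger `log(2/δ)` removes the restriction on `δ`.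
  · have hmono : ∀ L : ℝ, 0 ≤ L → 150 * η t * L ^ 3 ≤ 150 * η (t + 1) * L ^ 3 := fun L hL =>
      mul_le_mul_of_nonneg_right (mul_le_mul_of_nonneg_left (hηs t) (by norm_num)) (by positivity)
    have hL0 := GPUCB.log_div_nonneg hδ (show 1 ≤ t + 1 by omega)
    rcases Nat.lt_or_ge t 2 with h2 | h2
    · rcases Nat.eq_zero_or_pos t with h0 | h0
      · have : Q = 0 := by
          subst h0
          simp [hQ, GPUCB.fitForm]
        rw [this]
        have := hη0 (t + 1)
        positivity
      · obtain rfl : t = 1 := by omega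
        refine (hone _ rfl ?_).trans (hmono _ hL0)
        linarith [GPUCB.le_log_div hδ (show 2 ≤ 1 + 1 by omega)]
    · refine (htwo h2).trans (le_trans ?_ (hmono _ hL0))
      have h3 := pow_le_pow_left₀ (GPUCB.log_div_nonneg hδ (show 1 ≤ t by omega))
        (GPUCB.log_div_le_succ hδ (show 1 ≤ t by omega)) 3
      exact mul_le_mul_of_nonneg_left h3 (mul_nonneg (by norm_num) (hη0 t))
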